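/- Fix $\alpha>1$. The WARM on a finite graph $G$ with edges labelled $1,\dots,n$ is the urn model with one colour per edge in which, at every step, a vertex of $G$ is chosen uniformly at random, $A\subset\{1,\dots,n\}$ is the set of edges incident to it, and an edge $i\in A$ is selected with probability proportional to (its current number of balls)$^{\alpha}$ and reinforced by one ball. With $p_A$ the probability of choosing the set $A$, put, for $v$ in the simplex $\{v\in\mathbb R^n: v_i\ge 0,\ \sum_i v_i=1\}$ (and, by the same formula, for $v\in[0,\infty)^n$), $$F(v)_i=-v_i+\lim_{t\to\infty}\sum_{A\ni i}p_A\frac{(v_it)^{\alpha}}{\sum_{j\in A}(v_jt)^{\alpha}} .$$ An equilibrium is a point $v$ of the simplex with $F(v)=0$. Let $\mathbf D(v)=(\partial F(v)_i/\partial v_k)_{i,k}$ (right derivatives where $v_k=0$). An equilibrium is linearly stable if all eigenvalues of $\mathbf D(v)$ have negative real part, linearly unstable if some eigenvalue has positive real part, and critical otherwise. **Theorem.** Consider the WARM on the triangle graph (three vertices, three edges), with $\alpha>1$. At every equilibrium all partial derivatives in $\mathbf D$ exist, and, up to permutation of the coordinates (that is, when the coordinates are listed in decreasing order), the equilibria are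 exactly the following: (i) $(1/3,1/3,1/3)$, for all $\alpha>1$; (ii) $(1/2,1/2,0)$, for all $\alpha>1$; (iii) $(v,u,0)$ for $\alpha>3$, where $v=v(\alpha)>u=1-v$, and $v(\alpha)$ is strictly increasing with $v(3+)=1/2$ and $v(+\infty)=2/3$; here $(v,u)$ is an equilibrium of the WARM on the line graph with two edges; (iv) $(v,v,u)$ for $1<\alpha\le 4/3$, where $u=1-2v$, $v>u$ if $\alpha<4/3$, and $v(\alpha)$ is strictly decreasing with $v(1+)=1/2$ and $v(4/3-)=v(4/3)=1/3$; (v) $(v,u,u)$ for $\alpha\ge 4/3$, where $u=(1-v)/2$, $v>u$ if $\alpha>4/3$, and $v(\alpha)$ is strictly increasing with $v(4/3)=v(4/3+)=1/3$ and $v(+\infty)=2/3$. For each $\alpha$ in the stated range, the value $v(\alpha)$ in each of (iii), (iv), (v) is unique. At $\alpha=4/3$ both (iv) and (v) coincide with (i). Stability: equilibrium (i) is linearly stable if and only if $\alpha<4/3$, and critical if and only if $\alpha=4/3$; equilibrium (ii) is linearly stable if and only if $\alpha<3$, and critical if and only if $\alpha=3$; equilibrium (iii) is linearly stable for all $\alpha>3$;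 equilibria (iv) and (v) are never linearly stable, and are critical if and only if $\alpha=4/3$. -/

import Mathlib

open Filter Topology Set

noncomputable section

/-- For `n` colours, subset law `p` (`p A` is the probability that the set of available colours
is `A`) and reinforcement function `W`, this is the vector field
`F(v)_i = - v_i + lim_{t → ∞} ∑_{A ∋ i} p_A W(v_i t) / ∑_{j ∈ A} W(v_j t)`.
(When `W x = x ^ α` and all `v_j ≥ 0`, the sum does not depend on `t > 0`, so the limit exists.) -/
def warmField {n : ℕ} (p : Finset (Fin n) → ℝ) (W : ℝ → ℝ) (v : Fin n → ℝ) (i : Fin n) : ℝ :=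
  -v i + limUnder atTop (fun t : ℝ =>
    ∑ A : Finset (Fin n) with i ∈ A, p A * (W (v i * t) / ∑ j ∈ A, W (v j * t)))

/-- A point of the simplex at which the field vanishes. -/
def IsEquilibrium {n : ℕ} (p : Finset (Fin n) → ℝ) (W : ℝ → ℝ) (v : Fin n → ℝ) : Prop :=
  v ∈ stdSimplex ℝ (Fin n) ∧ ∀ i, warmField p W v i = 0

/-- `D` is the matrix of partial derivatives `D i k = ∂ F(v)_i / ∂ v_k` (in particular they all
exist). The field is only meaningful for nonnegative coordinates, so the derivative is the
two-sided one where `v_k > 0` and the right derivative where `v_k = 0`. -/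
def HasJacobian {n : ℕ} (p : Finset (Fin n) → ℝ) (W : ℝ → ℝ) (v : Fin n → ℝ)
    (D : Matrix (Fin n) (Fin n) ℝ) : Prop :=
  ∀ i k, HasDerivWithinAt (fun x : ℝ => warmField p W (Function.update v k x) i) (D i k)
    (Ici 0) (v k)

/-- `z` is a complex eigenvalue of the real matrix `D`. -/
def IsComplexEigenvalue {n : ℕ} (D : Matrix (Fin n) (Fin n) ℝ) (z : ℂ) : Prop :=
  Module.End.HasEigenvalue (Matrix.toLin' (D.map (algebraMap ℝ ℂ))) z

/-- Equilibrium at which all eigenvalues of the Jacobian matrix have negative real part. -/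
def IsLinearlyStable {n : ℕ} (p : Finset (Fin n) → ℝ) (W : ℝ → ℝ) (v : Fin n → ℝ) : Prop :=
  IsEquilibrium p W v ∧ ∃ D, HasJacobian p W v D ∧ ∀ z, IsComplexEigenvalue D z → z.re < 0

/-- Equilibrium at which some eigenvalue of the Jacobian matrix has positive real part. -/
def IsLinearlyUnstable {n : ℕ} (p : Finset (Fin n) → ℝ) (W : ℝ → ℝ) (v : Fin n → ℝ) : Prop :=
  IsEquilibrium p W v ∧ ∃ D, HasJacobian p W v D ∧ ∃ z, IsComplexEigenvalue D z ∧ 0 < z.re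

/-- Equilibrium (with a Jacobian matrix) that is neither linearly stable nor linearly unstable. -/
def IsCritical {n : ℕ} (p : Finset (Fin n) → ℝ) (W : ℝ → ℝ) (v : Fin n → ℝ) : Prop :=
  IsEquilibrium p W v ∧ (∃ D, HasJacobian p W v D) ∧
    ¬ IsLinearlyStable p W v ∧ ¬ IsLinearlyUnstable p W v

/-- Subset law of the WARM on the graph `G`, whose edges are the colours, labelled by `e`:
a vertex `x` is uniformly chosen and the available colours are the edges incident to `x`. -/
def graphLaw {V : Type*} [Fintype V] [DecidableEq V] {n : ℕ} (G : SimpleGraph V)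
    (e : Fin n ≃ G.edgeSet) (A : Finset (Fin n)) : ℝ :=
  ((Finset.univ.filter (fun x : V =>
      Finset.univ.filter (fun i : Fin n => x ∈ (e i : Sym2 V)) = A)).card : ℝ) / Fintype.card V

/-- The triangle graph. -/
abbrev triangleGraph : SimpleGraph (Fin 3) := ⊤

/-- The line graph (path) with two edges. -/
abbrev twoEdgeGraph : SimpleGraph (Fin 3) := SimpleGraph.pathGraph 3

/-- The reinforcement function `x ↦ x ^ α`. -/
def powerWeight (α : ℝ) (x : ℝ) : ℝ := x ^ α

end

/-! Each edge of the triangle competes with each of the other two at their common vertex, so the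
equilibrium equations read `3 * v i = ∑ j ≠ i, share α (v i) (v j)`. Since shares are at most 1,
every coordinate is at most 2/3, and at most one can vanish.

Three distinct positive coordinates are impossible (`not_isTriangleEquilibrium_of_lt`): with `A = a
^ α`, `B = b ^ α`, `C = c ^ α`, the equations prescribe the chord slopes of the convex function `X ↦
X ^ ((1 - α) / α)` between these points, and the prescribed slopes are in the wrong order. Hence two
coordinates agree or one is zero, and a single ratio `r` remains, with `r ^ α = 3 * r / (4 - r)` or
`r ^ α = (2 * r - 1) / (2 - r)`.

Put `r = exp y`. The equation becomes `α * y = h y` with `h 0 = 0` and `h` strictly convex (on `y ≥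
0` in the second case). Apart from the trivial solution `y = 0`, it says that `α` is the slope `h y
/ y`, which `dslope h 0` extends to `y = 0`. This slope is strictly increasing, so it can be
inverted: existence, uniqueness, monotonicity and limits of the branches follow, and the thresholds
4/3 and 3 are the values of `h' 0`.

The Jacobian has eigenvalue -1, and the equilibrium equations eliminate the powers from the other
two. In each family one of these is `-1 + α / h' y`, so its sign compares a chord of `h` with a
tangent, again by convexity. Only instability for `r > 1` with two equal coordinates uses the other
eigenvalue. -/

/-! ### Slopes of convex functions and right inverses of increasing ones. -/

theorem StrictConvexOn.strictMonoOn_dslope {S : Set ℝ} {h : ℝ → ℝ} {a c : ℝ}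
    (hconv : StrictConvexOn ℝ S h) (ha : a ∈ S) (hd : HasDerivAt h c a) :
    StrictMonoOn (dslope h a) S := by
  intro x hx y hy hxy
  rcases eq_or_ne x a with rfl | hxa
  · rw [dslope_same, dslope_of_ne _ hxy.ne', hd.deriv]
    exact hconv.lt_slope_of_hasDerivAt hx hy hxy hd
  · rcases eq_or_ne y a with rfl | hya
    · rw [dslope_same, dslope_of_ne _ hxy.ne, hd.deriv, slope_comm]
      exact hconv.slope_lt_of_hasDerivAt hx hy hxy hd
    · rw [dslope_of_ne _ hxa, dslope_of_ne _ hya, slope_def_field, slope_def_field]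
      exact hconv.secant_strict_mono ha hx hy hxa hya hxy

section RightInverse

variable {φ ψ : ℝ → ℝ} {S R : Set ℝ} (hφ : StrictMonoOn φ S)
  (hψ : ∀ α ∈ R, ψ α ∈ S ∧ φ (ψ α) = α)
include hφ hψ

theorem lt_rightInverse_iff {y α : ℝ} (hy : y ∈ S) (hα : α ∈ R) : y < ψ α ↔ φ y < α := by
  rw [← hφ.lt_iff_lt hy (hψ α hα).1, (hψ α hα).2]

theorem rightInverse_lt_iff {y α : ℝ} (hy : y ∈ S) (hα : α ∈ R) : ψ α < y ↔ α < φ y := by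
  rw [← hφ.lt_iff_lt (hψ α hα).1 hy, (hψ α hα).2]

theorem rightInverse_apply {y α : ℝ} (hy : y ∈ S) (hα : α ∈ R) (h : φ y = α) : ψ α = y :=
  hφ.injOn (hψ α hα).1 hy ((hψ α hα).2.trans h.symm)

theorem strictMonoOn_rightInverse : StrictMonoOn ψ R := fun α hα β hβ hαβ => by
  rw [lt_rightInverse_iff hφ hψ (hψ α hα).1 hβ, (hψ α hα).2]
  exact hαβ

end RightInverse

/-! ### The two exponent functions: convexity and range of their slopes. -/

/-- The exponent `h y` with `exp (h y) = 3 * exp y / (4 - exp y)`. -/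
noncomputable def twoEqualExponent (y : ℝ) : ℝ := y + Real.log 3 - Real.log (4 - Real.exp y)

/-- The exponent `h y` with `exp (h y) = (2 * exp y - 1) / (2 - exp y)`. -/
noncomputable def oneZeroExponent (y : ℝ) : ℝ :=
  Real.log (2 * Real.exp y - 1) - Real.log (2 - Real.exp y)

theorem hasDerivAt_twoEqualExponent {y : ℝ} (hy : Real.exp y < 4) :
    HasDerivAt twoEqualExponent (4 / (4 - Real.exp y)) y := by
  have h4 : 4 - Real.exp y ≠ 0 := by linarith
  have h := ((hasDerivAt_id y).add_const (Real.log 3)).sub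
    (((Real.hasDerivAt_exp y).const_sub 4).log h4)
  refine h.congr_deriv ?_
  field_simp
  ring

theorem hasDerivAt_oneZeroExponent {y : ℝ} (hy : Real.exp y < 2) (hy' : 1 < 2 * Real.exp y) :
    HasDerivAt oneZeroExponent
      (3 * Real.exp y / ((2 * Real.exp y - 1) * (2 - Real.exp y))) y := by
  have h1 : 2 - Real.exp y ≠ 0 := by linarith
  have h2 : 2 * Real.exp y - 1 ≠ 0 := by linarith
  have h := ((((Real.hasDerivAt_exp y).const_mul 2).sub_const 1).log h2).sub
    (((Real.hasDerivAt_exp y).const_sub 2).log h1)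
  refine h.congr_deriv ?_
  field_simp
  ring

theorem strictConvexOn_twoEqualExponent : StrictConvexOn ℝ (Iio (Real.log 4)) twoEqualExponent := by
  have hlt : ∀ {y : ℝ}, y ∈ Iio (Real.log 4) → Real.exp y < 4 := fun hy =>
    (Real.lt_log_iff_exp_lt (by norm_num)).1 hy
  refine StrictMonoOn.strictConvexOn_of_deriv (convex_Iio _)
    (fun y hy => (hasDerivAt_twoEqualExponent (hlt hy)).continuousAt.continuousWithinAt) ?_
  rw [interior_Iio]
  intro x hx y hy hxy
  rw [(hasDerivAt_twoEqualExponent (hlt hx)).deriv, (hasDerivAt_twoEqualExponent (hlt hy)).deriv]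
  have := hlt hx
  have := hlt hy
  have := Real.exp_lt_exp.2 hxy
  exact div_lt_div_of_pos_left (by norm_num) (by linarith) (by linarith)

/-- The derivative is `3 / (5 - 2 * (r + 1 / r))` with `r = exp y`, increasing for `r ≥ 1`. The
function is odd, so convexity holds only on the nonnegative side; this suffices because the larger
coordinate can be listed first. -/
theorem strictConvexOn_oneZeroExponent :
    StrictConvexOn ℝ (Ico 0 (Real.log 2)) oneZeroExponent := by
  have hlt : ∀ {y : ℝ}, y ∈ Ico 0 (Real.log 2) → 1 ≤ Real.exp y ∧ Real.exp y < 2 := fun hy =>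
    ⟨Real.one_le_exp hy.1, (Real.lt_log_iff_exp_lt (by norm_num)).1 hy.2⟩
  have hd : ∀ {y : ℝ}, y ∈ Ico 0 (Real.log 2) → _ := fun {y} hy =>
    hasDerivAt_oneZeroExponent (y := y) (hlt hy).2 (by linarith [(hlt hy).1])
  refine StrictMonoOn.strictConvexOn_of_deriv (convex_Ico _ _)
    (fun y hy => (hd hy).continuousAt.continuousWithinAt) ?_
  rw [interior_Ico]
  intro x hx y hy hxy
  have hx := Ioo_subset_Ico_self hx
  have hy := Ioo_subset_Ico_self hy
  rw [(hd hx).deriv, (hd hy).deriv]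
  obtain ⟨h1, h2⟩ := hlt hx
  obtain ⟨h3, h4⟩ := hlt hy
  have h5 := Real.exp_lt_exp.2 hxy
  generalize Real.exp x = a at *
  generalize Real.exp y = b at *
  have hab : 0 < a * b - 1 := by nlinarith
  rw [div_lt_div_iff₀ (mul_pos (by linarith) (by linarith)) (mul_pos (by linarith) (by linarith))]
  -- After cross-multiplication the two sides differ by a positive multiple of `(a * b - 1) * (b -
  -- a)`.
  nlinarith [mul_pos hab (sub_pos.2 h5)]

theorem twoEqualExponent_zero : twoEqualExponent 0 = 0 := by
  norm_num [twoEqualExponent]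

theorem oneZeroExponent_zero : oneZeroExponent 0 = 0 := by
  norm_num [oneZeroExponent]

theorem tendsto_const_sub_exp_log {c : ℝ} (hc : 0 < c) :
    Tendsto (fun y => Real.log (c - Real.exp y)) (𝓝[<] (Real.log c)) atBot := by
  refine Real.tendsto_log_nhdsGT_zero.comp (tendsto_nhdsWithin_iff.2 ⟨?_, ?_⟩)
  · have : Tendsto (fun y => c - Real.exp y) (𝓝 (Real.log c)) (𝓝 (c - Real.exp (Real.log c))) :=
      (continuous_const.sub Real.continuous_exp).tendsto _
    rw [Real.exp_log hc, sub_self] at this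
    exact this.mono_left nhdsWithin_le_nhds
  · filter_upwards [self_mem_nhdsWithin] with y hy
    exact sub_pos.2 ((Real.lt_log_iff_exp_lt hc).1 hy)

theorem dslope_zero_of_ne {h : ℝ → ℝ} (h0 : h 0 = 0) {y : ℝ} (hy : y ≠ 0) :
    dslope h 0 y = h y / y := by
  rw [dslope_of_ne _ hy, slope_def_field, h0, sub_zero, sub_zero]

theorem apply_eq_dslope_zero_mul {h : ℝ → ℝ} (h0 : h 0 = 0) (y : ℝ) :
    h y = dslope h 0 y * y := by
  have := sub_smul_dslope h 0 y
  rw [h0, sub_zero, sub_zero, smul_eq_mul] at this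
  linarith

theorem exp_twoEqualExponent {y : ℝ} (hy : Real.exp y < 4) :
    Real.exp (twoEqualExponent y) = 3 * Real.exp y / (4 - Real.exp y) := by
  rw [twoEqualExponent, Real.exp_sub, Real.exp_add, Real.exp_log (by norm_num),
    Real.exp_log (by linarith), mul_comm]

theorem exp_oneZeroExponent {y : ℝ} (hy : Real.exp y < 2) (hy' : 1 < 2 * Real.exp y) :
    Real.exp (oneZeroExponent y) = (2 * Real.exp y - 1) / (2 - Real.exp y) := by
  rw [oneZeroExponent, Real.exp_sub, Real.exp_log (by linarith), Real.exp_log (by linarith)]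

/-- Intermediate values: the slope `h y / y` tends to 1 at `-∞`, where `h y - y` stays bounded, and
to `∞` at `log 4`, where `h` blows up. -/
theorem Ioi_one_subset_image_dslope_twoEqualExponent :
    Ioi 1 ⊆ dslope twoEqualExponent 0 '' Iio (Real.log 4) := by
  have hlog : 0 < Real.log 4 := Real.log_pos (by norm_num)
  have hd : ∀ y ∈ Iio (Real.log 4), DifferentiableAt ℝ twoEqualExponent y := fun y hy =>
    (hasDerivAt_twoEqualExponent ((Real.lt_log_iff_exp_lt (by norm_num)).1 hy)).differentiableAt
  refine isPreconnected_Iio.intermediate_value_Ioi (l₁ := atBot) (l₂ := 𝓝[<] (Real.log 4))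
    (le_principal_iff.2 (Iio_mem_atBot _)) inf_le_right
    ((continuousOn_dslope (Iio_mem_nhds hlog)).2
      ⟨fun y hy => (hd y hy).continuousAt.continuousWithinAt, hd 0 hlog⟩) ?_ ?_
  · have h1 : Tendsto (fun y : ℝ => 1 + (Real.log 3 - Real.log (4 - Real.exp y)) / y) atBot
        (𝓝 (1 + 0)) := by
      refine tendsto_const_nhds.add (Tendsto.div_atBot (a := Real.log 3 - Real.log (4 - 0)) ?_ tendsto_id)
      exact tendsto_const_nhds.sub ((tendsto_const_nhds.sub Real.tendsto_exp_atBot).log (by norm_num))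
    rw [add_zero] at h1
    refine h1.congr' ?_
    filter_upwards [Iio_mem_atBot 0] with y hy
    have hy : y ≠ 0 := ne_of_lt hy
    rw [dslope_zero_of_ne twoEqualExponent_zero hy, twoEqualExponent]
    field_simp
    ring
  · have h1 : Tendsto (fun y : ℝ => (y + Real.log 3 + -Real.log (4 - Real.exp y)) * y⁻¹)
        (𝓝[<] (Real.log 4)) atTop := by
      refine Tendsto.atTop_mul_pos (inv_pos.2 hlog) ?_
        (((tendsto_inv₀ hlog.ne')).mono_left nhdsWithin_le_nhds)
      exact ((tendsto_id.mono_left nhdsWithin_le_nhds).add_const _).add_atTop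
        (tendsto_neg_atBot_atTop.comp (tendsto_const_sub_exp_log (by norm_num)))
    refine h1.congr' ?_
    filter_upwards [nhdsWithin_le_nhds (Ioi_mem_nhds hlog)] with y hy
    rw [dslope_zero_of_ne twoEqualExponent_zero (ne_of_gt hy), twoEqualExponent, div_eq_mul_inv]
    ring

theorem dslope_oneZeroExponent_zero : dslope oneZeroExponent 0 0 = 3 := by
  rw [dslope_same, (hasDerivAt_oneZeroExponent (by norm_num) (by norm_num)).deriv]
  norm_num

theorem dslope_twoEqualExponent_zero : dslope twoEqualExponent 0 0 = 4 / 3 := by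
  rw [dslope_same, (hasDerivAt_twoEqualExponent (by norm_num)).deriv]
  norm_num

theorem Ioi_three_subset_image_dslope_oneZeroExponent :
    Ioi 3 ⊆ dslope oneZeroExponent 0 '' Ico 0 (Real.log 2) := by
  have hlog : 0 < Real.log 2 := Real.log_pos (by norm_num)
  have hd : ∀ y ∈ Ico 0 (Real.log 2), DifferentiableAt ℝ oneZeroExponent y := fun y hy =>
    (hasDerivAt_oneZeroExponent ((Real.lt_log_iff_exp_lt (by norm_num)).1 hy.2)
      (by linarith [Real.one_le_exp hy.1])).differentiableAt
  have hd0 := hd 0 ⟨le_rfl, hlog⟩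
  have hcont : ContinuousOn (dslope oneZeroExponent 0) (Ico 0 (Real.log 2)) := by
    intro y hy
    rcases eq_or_ne y 0 with rfl | h
    · exact (continuousAt_dslope_same.2 hd0).continuousWithinAt
    · exact ((continuousAt_dslope_of_ne h).2 (hd y hy).continuousAt).continuousWithinAt
  have h2 : Tendsto (dslope oneZeroExponent 0) (𝓝[<] (Real.log 2)) atTop := by
    have h1 : Tendsto (fun y : ℝ => (Real.log (2 * Real.exp y - 1) + -Real.log (2 - Real.exp y))
        * y⁻¹) (𝓝[<] (Real.log 2)) atTop := by
      refine Tendsto.atTop_mul_pos (inv_pos.2 hlog) ?_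
        (((tendsto_inv₀ hlog.ne')).mono_left nhdsWithin_le_nhds)
      refine Tendsto.add_atTop (C := Real.log (2 * Real.exp (Real.log 2) - 1)) ?_
        (tendsto_neg_atBot_atTop.comp (tendsto_const_sub_exp_log (by norm_num)))
      refine Tendsto.mono_left ?_ nhdsWithin_le_nhds
      refine Tendsto.log ?_ (by rw [Real.exp_log (by norm_num)]; norm_num)
      exact ((continuous_const.mul Real.continuous_exp).sub continuous_const).tendsto _
    refine h1.congr' ?_
    filter_upwards [nhdsWithin_le_nhds (Ioi_mem_nhds hlog)] with y hy
    rw [dslope_zero_of_ne oneZeroExponent_zero (ne_of_gt hy), oneZeroExponent, div_eq_mul_inv]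
    ring
  have h3 := isPreconnected_Ico.intermediate_value_Ici (s := Ico 0 (Real.log 2))
    (l := 𝓝[<] (Real.log 2)) ⟨le_rfl, hlog⟩
    (le_principal_iff.2 (Ico_mem_nhdsLT hlog)) hcont h2
  rw [dslope_oneZeroExponent_zero] at h3
  exact Ioi_subset_Ici_self.trans h3

theorem rpow_eq_of_dslope_eq {h : ℝ → ℝ} (h0 : h 0 = 0) {y α : ℝ} (hy : dslope h 0 y = α) :
    Real.exp y ^ α = Real.exp (h y) := by
  rw [← Real.exp_mul, apply_eq_dslope_zero_mul h0, hy, mul_comm]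

/-- The point `y = 0` must be excluded: there the power equation holds for every `α`, while `dslope`
takes the single value `h' 0`. -/
theorem dslope_eq_of_rpow_eq {h : ℝ → ℝ} (h0 : h 0 = 0) {y α : ℝ} (hy0 : y ≠ 0)
    (hy : Real.exp y ^ α = Real.exp (h y)) : dslope h 0 y = α := by
  rw [← Real.exp_mul] at hy
  rw [dslope_zero_of_ne h0 hy0, ← Real.exp_injective hy]
  field_simp

theorem exists_rightInverse {φ : ℝ → ℝ} {S R : Set ℝ} (h : R ⊆ φ '' S) :
    ∃ ψ : ℝ → ℝ, ∀ α ∈ R, ψ α ∈ S ∧ φ (ψ α) = α :=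
  ⟨Function.invFunOn φ S, fun _ hα => ⟨Function.invFunOn_mem (h hα), Function.invFunOn_eq (h hα)⟩⟩

theorem one_lt_dslope_twoEqualExponent {y : ℝ} (hy : y < 0) :
    1 < dslope twoEqualExponent 0 y := by
  have hexp := Real.exp_lt_one_iff.2 hy
  rw [dslope_zero_of_ne twoEqualExponent_zero hy.ne, lt_div_iff_of_neg hy, twoEqualExponent]
  have := Real.log_lt_log (show (0 : ℝ) < 3 by norm_num) (show 3 < 4 - Real.exp y by linarith)
  linarith

/-! ### Coordinate ratios as functions of `α`. -/

/-- The ratio `r` of the distinct coordinate to the two equal ones at an equilibrium. -/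
theorem exists_twoEqualRatio : ∃ ρ : ℝ → ℝ,
    (∀ α > 1, 0 < ρ α ∧ ρ α < 4 ∧ ρ α ^ α = 3 * ρ α / (4 - ρ α)) ∧
    StrictMonoOn ρ (Ioi 1) ∧
    (∀ α > 1, ∀ r, 0 < r → r < 4 → r ≠ 1 → r ^ α = 3 * r / (4 - r) → r = ρ α) ∧
    ρ (4 / 3) = 1 ∧
    (∀ α > 1, α < 4 / 3 → ρ α < 1 ∧ 4 / (4 - ρ α) < α) ∧
    (∀ α > 4 / 3, 1 < ρ α) ∧
    Tendsto ρ (𝓝[>] 1) (𝓝 0) ∧ Tendsto ρ (𝓝 (4 / 3)) (𝓝 1) ∧ Tendsto ρ atTop (𝓝 4) := by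
  have hlog : 0 < Real.log 4 := Real.log_pos (by norm_num)
  have h4 : ∀ {y : ℝ}, y < Real.log 4 ↔ Real.exp y < 4 := Real.lt_log_iff_exp_lt (by norm_num)
  have hmono := strictConvexOn_twoEqualExponent.strictMonoOn_dslope (a := 0) hlog
    (hasDerivAt_twoEqualExponent (h4.1 hlog))
  obtain ⟨ψ, hψ⟩ := exists_rightInverse Ioi_one_subset_image_dslope_twoEqualExponent
  have hmem : ∀ {r : ℝ}, 0 < r → r < 4 → Real.log r ∈ Iio (Real.log 4) := fun h0 h4 =>
    Real.log_lt_log h0 h4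
  have hlt : ∀ {r α : ℝ}, 0 < r → r < 4 → 1 < α →
      (r < Real.exp (ψ α) ↔ dslope twoEqualExponent 0 (Real.log r) < α) := fun h0 h4 hα => by
    rw [← lt_rightInverse_iff hmono hψ (hmem h0 h4) hα, Real.log_lt_iff_lt_exp h0]
  have hgt : ∀ {r α : ℝ}, 0 < r → r < 4 → 1 < α →
      (Real.exp (ψ α) < r ↔ α < dslope twoEqualExponent 0 (Real.log r)) := fun h0 h4 hα => by
    rw [← rightInverse_lt_iff hmono hψ (hmem h0 h4) hα, Real.lt_log_iff_exp_lt h0]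
  have h1 : dslope twoEqualExponent 0 (Real.log 1) = 4 / 3 := by
    rw [Real.log_one, dslope_twoEqualExponent_zero]
  have hψ4 : ∀ α > 1, Real.exp (ψ α) < 4 := fun α hα => h4.1 (hψ α hα).1
  have hone : ψ (4 / 3) = 0 := rightInverse_apply hmono hψ hlog
    (show (1 : ℝ) < 4 / 3 by norm_num) dslope_twoEqualExponent_zero
  refine ⟨fun α => Real.exp (ψ α), fun α hα => ⟨Real.exp_pos _, hψ4 α hα, ?_⟩,
    fun α hα β hβ h => Real.exp_lt_exp.2 (strictMonoOn_rightInverse hmono hψ hα hβ h),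
    fun α hα r hr0 hr4 hr1 hr => ?_, ?_, fun α hα hα' => ?_, fun α hα => ?_, ?_, ?_, ?_⟩
  · rw [rpow_eq_of_dslope_eq twoEqualExponent_zero (hψ α hα).2, exp_twoEqualExponent (hψ4 α hα)]
  · suffices ψ α = Real.log r by simp only [this, Real.exp_log hr0]
    refine rightInverse_apply hmono hψ (hmem hr0 hr4) hα ?_
    refine dslope_eq_of_rpow_eq twoEqualExponent_zero
      (Real.log_ne_zero_of_pos_of_ne_one hr0 hr1) ?_
    rw [exp_twoEqualExponent (h4.1 (hmem hr0 hr4)), Real.exp_log hr0, hr]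
  · simp only [hone, Real.exp_zero]
  · have hneg : Real.exp (ψ α) < 1 := (hgt one_pos (by norm_num) hα).2 (by rwa [h1])
    have hψ0 : ψ α < 0 := by simpa using hneg
    -- The chord from `ψ α < 0` to 0 has slope `α`, which exceeds the slope of the tangent at its
    -- left end; this later gives instability.
    have := strictConvexOn_twoEqualExponent.lt_slope_of_hasDerivAt (hψ α hα).1 hlog hψ0
      (hasDerivAt_twoEqualExponent (hψ4 α hα))
    rw [slope_comm, ← dslope_of_ne _ hψ0.ne, (hψ α hα).2] at this
    exact ⟨hneg, this⟩
  · exact (hlt one_pos (by norm_num) (lt_trans (by norm_num) hα)).2 (by rwa [h1])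
  · refine tendsto_order.2 ⟨fun a ha => .of_forall fun α => ha.trans (Real.exp_pos _), fun a ha => ?_⟩
    -- The bound `a` is lowered to a ratio in `(0, 1)`, where the logarithm is negative and the
    -- slope exceeds 1. The other limits adjust their bounds similarly.
    have hb : 0 < min a (1 / 2) := lt_min ha (by norm_num)
    have hb1 : min a (1 / 2) < 1 := lt_of_le_of_lt (min_le_right _ _) (by norm_num)
    filter_upwards [Ioo_mem_nhdsGT (one_lt_dslope_twoEqualExponent (Real.log_neg hb hb1))]
      with α hα
    exact ((hgt hb (by linarith) hα.1).2 hα.2).trans_le (min_le_left _ _)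
  · refine tendsto_order.2 ⟨fun a ha => ?_, fun a ha => ?_⟩
    · have hb : 0 < max a (1 / 2) := lt_max_of_lt_right (by norm_num)
      have hb1 : max a (1 / 2) < 1 := max_lt ha (by norm_num)
      have hφ : dslope twoEqualExponent 0 (Real.log (max a (1 / 2))) < 4 / 3 := by
        rw [← h1]
        exact hmono (hmem hb (by linarith)) (hmem one_pos (by norm_num)) (Real.log_lt_log hb hb1)
      filter_upwards [Ioi_mem_nhds hφ, Ioi_mem_nhds (show (1 : ℝ) < 4 / 3 by norm_num)] with α hα hα1
      exact (le_max_left _ _).trans_lt ((hlt hb (by linarith) hα1).2 hα)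
    · have hb : 1 < min a 2 := lt_min ha (by norm_num)
      have hb1 : min a 2 < 4 := lt_of_le_of_lt (min_le_right _ _) (by norm_num)
      have hφ : 4 / 3 < dslope twoEqualExponent 0 (Real.log (min a 2)) := by
        rw [← h1]
        exact hmono (hmem one_pos (by norm_num)) (hmem (by linarith) hb1)
          (Real.log_lt_log one_pos hb)
      filter_upwards [Iio_mem_nhds hφ, Ioi_mem_nhds (show (1 : ℝ) < 4 / 3 by norm_num)] with α hα hα1
      exact ((hgt (by linarith) hb1 hα1).2 hα).trans_le (min_le_left _ _)
  · refine tendsto_order.2 ⟨fun a ha => ?_, fun a ha => ?_⟩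
    · have hb : 0 < max a 1 := lt_max_of_lt_right (by norm_num)
      have hb1 : max a 1 < 4 := max_lt ha (by norm_num)
      filter_upwards [Ioi_mem_atTop 1, Ioi_mem_atTop (dslope twoEqualExponent 0 (Real.log (max a 1)))]
        with α hα1 hα
      exact (le_max_left _ _).trans_lt ((hlt hb hb1 hα1).2 hα)
    · filter_upwards [Ioi_mem_atTop 1] with α hα1
      exact (hψ4 α hα1).trans ha

/-- The ratio `r > 1` of the two positive coordinates at an equilibrium with one zero. -/
theorem exists_oneZeroRatio : ∃ ρ : ℝ → ℝ,
    (∀ α > 3, 1 < ρ α ∧ ρ α < 2 ∧ ρ α ^ α = (2 * ρ α - 1) / (2 - ρ α) ∧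
      α < 3 * ρ α / ((2 * ρ α - 1) * (2 - ρ α))) ∧
    StrictMonoOn ρ (Ioi 3) ∧
    (∀ α, ∀ r, 1 < r → r < 2 → r ^ α = (2 * r - 1) / (2 - r) → 3 < α ∧ r = ρ α) ∧
    Tendsto ρ (𝓝[>] 3) (𝓝 1) ∧ Tendsto ρ atTop (𝓝 2) := by
  have hlog : 0 < Real.log 2 := Real.log_pos (by norm_num)
  have h2 : ∀ {y : ℝ}, y < Real.log 2 ↔ Real.exp y < 2 := Real.lt_log_iff_exp_lt (by norm_num)
  have h0mem : (0 : ℝ) ∈ Ico 0 (Real.log 2) := ⟨le_rfl, hlog⟩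
  have hmono := strictConvexOn_oneZeroExponent.strictMonoOn_dslope h0mem
    (hasDerivAt_oneZeroExponent (h2.1 hlog) (by norm_num))
  obtain ⟨ψ, hψ⟩ := exists_rightInverse Ioi_three_subset_image_dslope_oneZeroExponent
  have hmem : ∀ {r : ℝ}, 1 < r → r < 2 → Real.log r ∈ Ico 0 (Real.log 2) := fun h1 h2 =>
    ⟨(Real.log_pos h1).le, Real.log_lt_log (by linarith) h2⟩
  have hlt : ∀ {r α : ℝ}, 1 < r → r < 2 → 3 < α →
      (r < Real.exp (ψ α) ↔ dslope oneZeroExponent 0 (Real.log r) < α) := fun h0 h4 hα => by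
    rw [← lt_rightInverse_iff hmono hψ (hmem h0 h4) hα, Real.log_lt_iff_lt_exp (by linarith)]
  have hgt : ∀ {r α : ℝ}, 1 < r → r < 2 → 3 < α →
      (Real.exp (ψ α) < r ↔ α < dslope oneZeroExponent 0 (Real.log r)) := fun h0 h4 hα => by
    rw [← rightInverse_lt_iff hmono hψ (hmem h0 h4) hα, Real.lt_log_iff_exp_lt (by linarith)]
  have hthree : ∀ {r : ℝ}, 1 < r → r < 2 → 3 < dslope oneZeroExponent 0 (Real.log r) := by
    intro r hr hr2
    rw [← dslope_oneZeroExponent_zero]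
    exact hmono h0mem (hmem hr hr2) (Real.log_pos hr)
  have hψ2 : ∀ α > 3, Real.exp (ψ α) < 2 := fun α hα => h2.1 (hψ α hα).1.2
  have hψ0 : ∀ α > 3, 0 < ψ α := fun α hα => by
    rw [lt_rightInverse_iff hmono hψ h0mem hα, dslope_oneZeroExponent_zero]
    exact hα
  have hψ1 : ∀ α > 3, 1 < Real.exp (ψ α) := fun α hα => Real.one_lt_exp_iff.2 (hψ0 α hα)
  refine ⟨fun α => Real.exp (ψ α), fun α hα => ⟨hψ1 α hα, hψ2 α hα, ?_, ?_⟩,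
    fun α hα β hβ h => Real.exp_lt_exp.2 (strictMonoOn_rightInverse hmono hψ hα hβ h),
    fun α r hr1 hr2 hr => ?_, ?_, ?_⟩
  · rw [rpow_eq_of_dslope_eq oneZeroExponent_zero (hψ α hα).2,
      exp_oneZeroExponent (hψ2 α hα) (by linarith [hψ1 α hα])]
  -- Here the tangent is taken at the right end of the chord, so it is steeper than `α`; this later
  -- gives stability.
  · have := strictConvexOn_oneZeroExponent.slope_lt_of_hasDerivAt h0mem (hψ α hα).1 (hψ0 α hα)
      (hasDerivAt_oneZeroExponent (hψ2 α hα) (by linarith [hψ1 α hα]))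
    rwa [← dslope_of_ne _ (hψ0 α hα).ne', (hψ α hα).2] at this
  · have hα : dslope oneZeroExponent 0 (Real.log r) = α := by
      refine dslope_eq_of_rpow_eq oneZeroExponent_zero (Real.log_pos hr1).ne' ?_
      rw [exp_oneZeroExponent (h2.1 (hmem hr1 hr2).2) (by rw [Real.exp_log] <;> linarith),
        Real.exp_log (by linarith), hr]
    have h3 : 3 < α := hα ▸ hthree hr1 hr2
    refine ⟨h3, ?_⟩
    simp only [rightInverse_apply hmono hψ (hmem hr1 hr2) h3 hα, Real.exp_log (one_pos.trans hr1)]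
  · refine tendsto_order.2 ⟨fun a ha => ?_, fun a ha => ?_⟩
    · filter_upwards [self_mem_nhdsWithin] with α hα
      exact ha.trans (hψ1 α hα)
    · have hb : 1 < min a (3 / 2) := lt_min ha (by norm_num)
      have hb1 : min a (3 / 2) < 2 := lt_of_le_of_lt (min_le_right _ _) (by norm_num)
      filter_upwards [Ioo_mem_nhdsGT (hthree hb hb1)] with α hα
      exact ((hgt hb hb1 hα.1).2 hα.2).trans_le (min_le_left _ _)
  · refine tendsto_order.2 ⟨fun a ha => ?_, fun a ha => ?_⟩
    · have hb : 1 < max a (3 / 2) := lt_max_of_lt_right (by norm_num)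
      have hb1 : max a (3 / 2) < 2 := max_lt ha (by norm_num)
      filter_upwards [Ioi_mem_atTop 3,
        Ioi_mem_atTop (dslope oneZeroExponent 0 (Real.log (max a (3 / 2))))] with α hα1 hα
      exact (le_max_left _ _).trans_lt ((hlt hb hb1 hα1).2 hα)
    · filter_upwards [Ioi_mem_atTop 3] with α hα1
      exact (hψ2 α hα1).trans ha

/-! ### The field on the triangle and on the path. -/

theorem warmField_powerWeight {n : ℕ} (p : Finset (Fin n) → ℝ) (α : ℝ) {v : Fin n → ℝ}
    (hv : ∀ i, 0 ≤ v i) (i : Fin n) :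
    warmField p (powerWeight α) v i =
      -v i + ∑ A : Finset (Fin n) with i ∈ A, p A * (v i ^ α / ∑ j ∈ A, v j ^ α) := by
  rw [warmField]
  congr 1
  refine Tendsto.limUnder_eq (tendsto_const_nhds.congr' ?_)
  filter_upwards [Ioi_mem_atTop 0] with t ht
  refine Finset.sum_congr rfl fun A _ => ?_
  have ht' : t ^ α ≠ 0 := (Real.rpow_pos_of_pos ht α).ne'
  simp only [powerWeight, Real.mul_rpow (hv _) (le_of_lt (mem_Ioi.1 ht)), ← Finset.sum_mul]
  rw [mul_div_mul_right _ _ ht']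

theorem sum_graphLaw_mul {V : Type*} [Fintype V] [DecidableEq V] {n : ℕ} (G : SimpleGraph V)
    (e : Fin n ≃ G.edgeSet) (g : Finset (Fin n) → ℝ) (i : Fin n) :
    ∑ A : Finset (Fin n) with i ∈ A, graphLaw G e A * g A =
      (∑ x : V with x ∈ (e i : Sym2 V),
        g (Finset.univ.filter fun j : Fin n => x ∈ (e j : Sym2 V))) / Fintype.card V := by
  simp only [graphLaw, Finset.card_filter, Nat.cast_sum, Nat.cast_ite, Nat.cast_one, Nat.cast_zero,
    div_mul_eq_mul_div, ← Finset.sum_div, Finset.sum_mul, ite_mul, one_mul, zero_mul]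
  congr 1
  rw [Finset.sum_comm, Finset.sum_filter]
  refine Finset.sum_congr rfl fun x _ => ?_
  rw [Finset.sum_ite_eq]
  simp only [Finset.mem_filter, Finset.mem_univ, true_and]

/-- An edge of the triangle is determined by the vertex it misses. Reindexing vertices by opposite
edges makes the labelling `e` disappear from the field. -/
theorem exists_oppositeVertex (e : Fin 3 ≃ triangleGraph.edgeSet) :
    ∃ τ : Fin 3 ≃ Fin 3, ∀ x i, x ∈ (e i : Sym2 (Fin 3)) ↔ x ≠ τ i := by
  have key : ∀ s : Sym2 (Fin 3), ¬ s.IsDiag → ∃ y, ∀ x, x ∈ s ↔ x ≠ y := by decide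
  have hdiag : ∀ i, ¬ (e i : Sym2 (Fin 3)).IsDiag := fun i =>
    SimpleGraph.not_isDiag_of_mem_edgeSet _ (e i).2
  choose τ hτ using fun i => key _ (hdiag i)
  have hinj : Function.Injective τ := fun i j hij => by
    refine e.injective (Subtype.ext (Sym2.ext fun x => ?_))
    rw [hτ, hτ, hij]
  exact ⟨Equiv.ofBijective τ (Finite.injective_iff_bijective.1 hinj), fun x i => hτ i x⟩

/-- The share `a ^ α / (a ^ α + b ^ α)` of the first colour in a competition of two. -/
noncomputable def share (α a b : ℝ) : ℝ := a ^ α / (a ^ α + b ^ α)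

theorem warmField_triangleGraph (e : Fin 3 ≃ triangleGraph.edgeSet) (α : ℝ) {v : Fin 3 → ℝ}
    (hv : ∀ i, 0 ≤ v i) (i : Fin 3) :
    warmField (graphLaw triangleGraph e) (powerWeight α) v i =
      -v i + (∑ j with j ≠ i, share α (v i) (v j)) / 3 := by
  obtain ⟨τ, hτ⟩ := exists_oppositeVertex e
  rw [warmField_powerWeight _ _ hv,
    sum_graphLaw_mul triangleGraph e (fun A => v i ^ α / ∑ j ∈ A, v j ^ α)]
  simp only [hτ, Fintype.card_fin, Nat.cast_ofNat]
  congr 2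
  rw [Finset.sum_filter, ← Equiv.sum_comp τ]
  simp only [ne_eq, EmbeddingLike.apply_eq_iff_eq, Finset.sum_filter, Fin.sum_univ_three, share]
  fin_cases i <;> simp <;> ring

/-- At its leaf an edge is alone and wins with share 1; at the middle vertex it competes with the
other edge `1 - i`. -/
theorem warmField_twoEdgeGraph (e : Fin 2 ≃ twoEdgeGraph.edgeSet) (α : ℝ) {v : Fin 2 → ℝ}
    (hv : ∀ i, 0 < v i) (i : Fin 2) :
    warmField (graphLaw twoEdgeGraph e) (powerWeight α) v i =
      -v i + (1 + share α (v i) (v (1 - i))) / 3 := by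
  have key : ∀ s ∈ twoEdgeGraph.edgeSet, s = s(1, 0) ∨ s = s(1, 2) := by
    intro s
    induction s with | _ x y
    fin_cases x <;> fin_cases y <;> simp [SimpleGraph.pathGraph_adj]
  have hne : (e 0 : Sym2 (Fin 3)) ≠ e 1 := fun h => by simpa using e.injective (Subtype.ext h)
  have hpos := fun i => (Real.rpow_pos_of_pos (hv i) α).ne'
  rw [warmField_powerWeight _ _ (fun i => (hv i).le),
    sum_graphLaw_mul twoEdgeGraph e (fun A => v i ^ α / ∑ j ∈ A, v j ^ α)]
  simp only [Fintype.card_fin, Nat.cast_ofNat]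
  congr 2
  rcases key _ (e 0).2 with h0 | h0 <;> rcases key _ (e 1).2 with h1 | h1
  · exact absurd (h0.trans h1.symm) hne
  · simp only [Finset.sum_filter, Fin.sum_univ_three, share]
    fin_cases i <;> simp [h0, h1, hpos] <;> ring
  · simp only [Finset.sum_filter, Fin.sum_univ_three, share]
    fin_cases i <;> simp [h0, h1, hpos] <;> ring
  · exact absurd (h0.trans h1.symm) hne

/-! ### The Jacobian matrix and its eigenvalues. -/

theorem hasDerivAt_share_left {α a b : ℝ} (hα : 1 < α) (hab : a ^ α + b ^ α ≠ 0) :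
    HasDerivAt (fun x => share α x b) (α * a ^ (α - 1) * b ^ α / (a ^ α + b ^ α) ^ 2) a := by
  have h := Real.hasDerivAt_rpow_const (x := a) (Or.inr hα.le)
  refine (h.fun_div (h.add_const (b ^ α)) hab).congr_deriv ?_
  ring

theorem hasDerivAt_share_right {α a b : ℝ} (hα : 1 < α) (hab : a ^ α + b ^ α ≠ 0) :
    HasDerivAt (fun x => share α a x) (-(α * a ^ α * b ^ (α - 1) / (a ^ α + b ^ α) ^ 2)) b := by
  have h := Real.hasDerivAt_rpow_const (x := b) (Or.inr hα.le)
  refine ((hasDerivAt_const b (a ^ α)).fun_div (h.const_add (a ^ α)) hab).congr_deriv ?_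
  ring

/-- The Jacobian matrix of the field of the triangle. -/
noncomputable def triangleJacobian (α : ℝ) (v : Fin 3 → ℝ) : Matrix (Fin 3) (Fin 3) ℝ :=
  Matrix.of fun i k =>
    if i = k then
      -1 + (∑ j with j ≠ i, α * v i ^ (α - 1) * v j ^ α / (v i ^ α + v j ^ α) ^ 2) / 3
    else -(α * v i ^ α * v k ^ (α - 1) / (v i ^ α + v k ^ α) ^ 2) / 3

theorem hasJacobian_triangleJacobian (e : Fin 3 ≃ triangleGraph.edgeSet) {α : ℝ} (hα : 1 < α)
    {v : Fin 3 → ℝ} (hv : ∀ i, 0 ≤ v i) (hv2 : ∀ i j, i ≠ j → v i ^ α + v j ^ α ≠ 0) :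
    HasJacobian (graphLaw triangleGraph e) (powerWeight α) v (triangleJacobian α v) := by
  intro i k
  have hupd : ∀ x ∈ Ici (0 : ℝ), ∀ j, 0 ≤ Function.update v k x j := fun x hx j => by
    rcases eq_or_ne j k with rfl | h
    · simpa using hx
    · simpa [h] using hv j
  refine HasDerivWithinAt.congr_of_mem ?_
    (fun x hx => warmField_triangleGraph e α (hupd x hx) i) (hv k)
  refine HasDerivAt.hasDerivWithinAt ?_
  rcases eq_or_ne i k with rfl | hik
  · simp only [triangleJacobian, Matrix.of_apply, if_true, Function.update_self]
    refine (hasDerivAt_neg _).add (HasDerivAt.div_const (HasDerivAt.fun_sum fun j hj => ?_) 3)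
    have hj : j ≠ i := (Finset.mem_filter.1 hj).2
    simp only [Function.update_of_ne hj]
    exact hasDerivAt_share_left hα (hv2 i j hj.symm)
  · simp only [triangleJacobian, Matrix.of_apply, if_neg hik, Function.update_of_ne hik]
    refine HasDerivAt.const_add _ (HasDerivAt.div_const ?_ 3)
    -- Only the summand `j = k` depends on the moving coordinate, so the derivative is spread over
    -- the sum with zeros elsewhere.
    have hsum : ∀ d : ℝ, d = ∑ j : Fin 3 with j ≠ i, if j = k then d else 0 := fun d => by
      simp [Finset.sum_ite_eq', hik.symm]
    rw [hsum (-_)]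
    refine HasDerivAt.fun_sum fun j hj => ?_
    rcases eq_or_ne j k with rfl | hjk
    · simp only [Function.update_self, if_true]
      exact hasDerivAt_share_right hα (hv2 i j hik)
    · simp only [Function.update_of_ne hjk, if_neg hjk]
      exact hasDerivAt_const _ _

/-- Makes the existential `D` in the stability definitions harmless: one computed Jacobian decides
them. -/
theorem HasJacobian.unique {n : ℕ} {p : Finset (Fin n) → ℝ} {W : ℝ → ℝ} {v : Fin n → ℝ}
    {D D' : Matrix (Fin n) (Fin n) ℝ} (hv : ∀ i, 0 ≤ v i) (h : HasJacobian p W v D)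
    (h' : HasJacobian p W v D') : D = D' := by
  ext i k
  exact UniqueDiffWithinAt.eq_deriv _ (uniqueDiffOn_Ici 0 _ (hv k)) (h i k) (h' i k)

theorem isComplexEigenvalue_iff_of_det {D : Matrix (Fin 3) (Fin 3) ℝ} {a b c : ℝ}
    (h : ∀ t, (Matrix.scalar (Fin 3) t - D).det = (t - a) * (t - b) * (t - c)) (z : ℂ) :
    IsComplexEigenvalue D z ↔ z = a ∨ z = b ∨ z = c := by
  have hD : D.charpoly = (Polynomial.X - Polynomial.C a) * (Polynomial.X - Polynomial.C b) *
      (Polynomial.X - Polynomial.C c) := by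
    refine Polynomial.funext fun t => ?_
    rw [Matrix.eval_charpoly, h]
    simp
  rw [IsComplexEigenvalue, Module.End.hasEigenvalue_iff_isRoot_charpoly, Matrix.charpoly_toLin',
    Matrix.charpoly_map, hD]
  simp [Polynomial.IsRoot, sub_eq_zero, or_assoc]

section Stability

variable {p : Finset (Fin 3) → ℝ} {W : ℝ → ℝ} {v : Fin 3 → ℝ} {D : Matrix (Fin 3) (Fin 3) ℝ}
  {a b : ℝ} (hv : IsEquilibrium p W v) (hD : HasJacobian p W v D)
  (hdet : ∀ t, (Matrix.scalar (Fin 3) t - D).det = (t - (-1)) * (t - a) * (t - b))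
include hv hD hdet

theorem isLinearlyStable_iff_of_det : IsLinearlyStable p W v ↔ a < 0 ∧ b < 0 := by
  constructor
  · rintro ⟨_, D', hD', h⟩
    obtain rfl := hD.unique hv.1.1 hD'
    simp only [isComplexEigenvalue_iff_of_det hdet] at h
    exact ⟨by simpa using h a (by simp), by simpa using h b (by simp)⟩
  · rintro ⟨ha, hb⟩
    refine ⟨hv, D, hD, fun z hz => ?_⟩
    rcases (isComplexEigenvalue_iff_of_det hdet z).1 hz with rfl | rfl | rfl <;> simp [*]

theorem isLinearlyUnstable_iff_of_det : IsLinearlyUnstable p W v ↔ 0 < a ∨ 0 < b := by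
  constructor
  · rintro ⟨_, D', hD', z, hz, h⟩
    obtain rfl := hD.unique hv.1.1 hD'
    rcases (isComplexEigenvalue_iff_of_det hdet z).1 hz with rfl | rfl | rfl
    · norm_num at h
    · exact Or.inl (by simpa using h)
    · exact Or.inr (by simpa using h)
  · rintro (h | h)
    · exact ⟨hv, D, hD, a, (isComplexEigenvalue_iff_of_det hdet _).2 (by simp), by simpa⟩
    · exact ⟨hv, D, hD, b, (isComplexEigenvalue_iff_of_det hdet _).2 (by simp), by simpa⟩

theorem isCritical_iff_of_det : IsCritical p W v ↔ max a b = 0 := by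
  rw [IsCritical, isLinearlyStable_iff_of_det hv hD hdet, isLinearlyUnstable_iff_of_det hv hD hdet,
    ← max_lt_iff, ← lt_max_iff, not_lt, not_lt, and_iff_right hv, and_iff_right ⟨D, hD⟩,
    ← le_antisymm_iff, eq_comm]

end Stability

/-! ### Shares and the equilibrium equations. -/

theorem share_pos_mul {α t a b : ℝ} (ht : 0 < t) (ha : 0 ≤ a) (hb : 0 ≤ b) :
    share α (t * a) (t * b) = share α a b := by
  have ht' : t ^ α ≠ 0 := (Real.rpow_pos_of_pos ht α).ne'
  rw [share, Real.mul_rpow ht.le ha, Real.mul_rpow ht.le hb, ← mul_add, mul_div_mul_left _ _ ht',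
    share]

theorem share_self {α a : ℝ} (ha : 0 < a) : share α a a = 1 / 2 := by
  have h := Real.rpow_pos_of_pos ha α
  rw [share]
  field_simp
  norm_num

theorem share_zero_right {α a : ℝ} (hα : α ≠ 0) (ha : 0 < a) : share α a 0 = 1 := by
  rw [share, Real.zero_rpow hα, add_zero, div_self (Real.rpow_pos_of_pos ha α).ne']

theorem share_zero_left {α a : ℝ} (hα : α ≠ 0) : share α 0 a = 0 := by
  rw [share, Real.zero_rpow hα, zero_div]

/-- Logarithmic differentiation of a share. At `a = 0` both sides vanish, the left because `α > 1`
and the right because `α / 0 = 0`. -/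
theorem mul_rpow_sub_one_div_eq {α a b : ℝ} (hα : 1 < α) (ha : 0 ≤ a) :
    α * a ^ (α - 1) * b ^ α / (a ^ α + b ^ α) ^ 2 = α / a * (share α a b * share α b a) := by
  rcases ha.eq_or_lt with rfl | ha
  · simp [Real.zero_rpow (sub_ne_zero.2 hα.ne')]
  · rw [Real.rpow_sub_one ha.ne', share, share, add_comm (b ^ α)]
    field_simp

/-- The equilibrium equations of the triangle. -/
def IsTriangleEquilibrium (α : ℝ) (v : Fin 3 → ℝ) : Prop :=
  (∀ i, 0 ≤ v i) ∧ ∑ i, v i = 1 ∧ ∀ i, 3 * v i = ∑ j with j ≠ i, share α (v i) (v j)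

theorem isEquilibrium_triangleGraph_iff (e : Fin 3 ≃ triangleGraph.edgeSet) (α : ℝ)
    (v : Fin 3 → ℝ) :
    IsEquilibrium (graphLaw triangleGraph e) (powerWeight α) v ↔ IsTriangleEquilibrium α v := by
  rw [IsEquilibrium, IsTriangleEquilibrium, stdSimplex, mem_ofPred_eq, and_assoc]
  refine and_congr_right fun hv => and_congr_right fun _ => forall_congr' fun i => ?_
  rw [warmField_triangleGraph e α hv]
  constructor <;> intro h <;> linarith

theorem IsTriangleEquilibrium.comp_perm {α : ℝ} {v : Fin 3 → ℝ} (h : IsTriangleEquilibrium α v)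
    (σ : Equiv.Perm (Fin 3)) : IsTriangleEquilibrium α (v ∘ σ) := by
  refine ⟨fun i => h.1 _, (Equiv.sum_comp σ v).trans h.2.1, fun i => (h.2.2 (σ i)).trans ?_⟩
  rw [Finset.sum_filter, Finset.sum_filter, ← Equiv.sum_comp σ]
  simp

theorem IsTriangleEquilibrium.of_comp_perm {α : ℝ} {v : Fin 3 → ℝ} (σ : Equiv.Perm (Fin 3))
    (h : IsTriangleEquilibrium α (v ∘ σ)) : IsTriangleEquilibrium α v := by
  simpa [Function.comp_assoc] using h.comp_perm σ⁻¹

theorem isTriangleEquilibrium_vec_iff {α a b c : ℝ} :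
    IsTriangleEquilibrium α ![a, b, c] ↔ (0 ≤ a ∧ 0 ≤ b ∧ 0 ≤ c) ∧ a + b + c = 1 ∧
      3 * a = share α a b + share α a c ∧ 3 * b = share α b a + share α b c ∧
      3 * c = share α c a + share α c b := by
  simp [IsTriangleEquilibrium, Fin.forall_fin_succ, Fin.sum_univ_three, Finset.sum_filter]

theorem isTriangleEquilibrium_twoEqual_iff {α r : ℝ} (hr : 0 ≤ r) :
    IsTriangleEquilibrium α ![1 / (2 + r), 1 / (2 + r), r / (2 + r)] ↔
      r ^ α * (4 - r) = 3 * r := by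
  have h2 : 0 < 2 + r := by linarith
  have hR : 0 ≤ r ^ α := Real.rpow_nonneg hr α
  have hs : share α (1 / (2 + r)) (1 / (2 + r)) = 1 / 2 := share_self (by positivity)
  have hs1 : share α (1 / (2 + r)) (r / (2 + r)) = 1 / (1 + r ^ α) := by
    have := share_pos_mul (α := α) (one_div_pos.2 h2) zero_le_one hr
    rw [mul_one, one_div_mul_eq_div] at this
    rw [this, share, Real.one_rpow]
  have hs2 : share α (r / (2 + r)) (1 / (2 + r)) = r ^ α / (1 + r ^ α) := by
    have := share_pos_mul (α := α) (one_div_pos.2 h2) hr zero_le_one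
    rw [mul_one, one_div_mul_eq_div] at this
    rw [this, share, Real.one_rpow, add_comm]
  have h1R : 0 < 1 + r ^ α := by positivity
  rw [isTriangleEquilibrium_vec_iff, hs, hs1, hs2]
  have hpos : (0 ≤ 1 / (2 + r) ∧ 0 ≤ 1 / (2 + r) ∧ 0 ≤ r / (2 + r)) := by
    refine ⟨?_, ?_, ?_⟩ <;> positivity
  constructor
  · rintro ⟨_, _, _, _, h⟩
    field_simp at h
    linarith
  · intro h
    refine ⟨hpos, by field_simp; ring, ?_, ?_, ?_⟩ <;> field_simp <;> linarith

theorem isTriangleEquilibrium_oneZero_iff {α r : ℝ} (hα : 1 < α) (hr : 0 < r) :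
    IsTriangleEquilibrium α ![r / (1 + r), 1 / (1 + r), 0] ↔ r ^ α * (2 - r) = 2 * r - 1 := by
  have h1 : 0 < 1 + r := by linarith
  have hα0 : α ≠ 0 := by linarith
  have hR : 0 < r ^ α := Real.rpow_pos_of_pos hr α
  have hs1 : share α (1 / (1 + r)) (r / (1 + r)) = 1 / (1 + r ^ α) := by
    have := share_pos_mul (α := α) (one_div_pos.2 h1) zero_le_one hr.le
    rw [mul_one, one_div_mul_eq_div] at this
    rw [this, share, Real.one_rpow]
  have hs2 : share α (r / (1 + r)) (1 / (1 + r)) = r ^ α / (1 + r ^ α) := by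
    have := share_pos_mul (α := α) (one_div_pos.2 h1) hr.le zero_le_one
    rw [mul_one, one_div_mul_eq_div] at this
    rw [this, share, Real.one_rpow, add_comm]
  have hpos1 : 0 < r / (1 + r) := by positivity
  have hpos2 : 0 < 1 / (1 + r) := by positivity
  rw [isTriangleEquilibrium_vec_iff, hs1, hs2, share_zero_right hα0 hpos1,
    share_zero_right hα0 hpos2, share_zero_left hα0, share_zero_left hα0]
  constructor
  · rintro ⟨_, _, h, _⟩
    field_simp at h
    linarith
  · intro h
    refine ⟨⟨hpos1.le, hpos2.le, le_rfl⟩, by field_simp; ring, ?_, ?_, by norm_num⟩ <;>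
      field_simp <;> linarith

/-! ### Excluding three distinct positive coordinates. -/

theorem convexOn_rpow_neg {κ : ℝ} (hκ : κ ≤ 0) : ConvexOn ℝ (Ioi 0) fun x : ℝ => x ^ κ := by
  have hlog : ConvexOn ℝ (Ioi 0) fun x : ℝ => Real.log x * κ := by
    have := (strictConcaveOn_log_Ioi.concaveOn.neg).smul (neg_nonneg.2 hκ)
    simpa [mul_comm] using this
  refine ⟨convex_Ioi 0, fun x hx y hy a b ha hb hab => ?_⟩
  have hz := convex_Ioi (0 : ℝ) hx hy ha hb hab
  simp only [Real.rpow_def_of_pos (mem_Ioi.1 hx), Real.rpow_def_of_pos (mem_Ioi.1 hy),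
    Real.rpow_def_of_pos (mem_Ioi.1 hz)]
  exact (Real.exp_le_exp.2 (hlog.2 hx hy ha hb hab)).trans
    (convexOn_exp.2 (mem_univ _) (mem_univ _) ha hb hab)

/-- No equilibrium has three distinct positive coordinates. -/
theorem not_isTriangleEquilibrium_of_lt {α a b c : ℝ} (hα : 1 < α) (hc : 0 < c) (hcb : c < b)
    (hba : b < a) : ¬ IsTriangleEquilibrium α ![a, b, c] := by
  rw [isTriangleEquilibrium_vec_iff]
  rintro ⟨_, _, h1, h2, h3⟩
  have hα0 : 0 < α := by linarith
  -- In the variable `X = x ^ α` the quotient `x / x ^ α` is a power with negative exponent, hence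
  -- convex.
  have hf : ∀ x : ℝ, 0 < x → (x ^ α) ^ ((1 - α) / α) = x / x ^ α := fun x hx => by
    rw [← Real.rpow_mul hx.le, mul_div_cancel₀ _ hα0.ne', Real.rpow_sub hx, Real.rpow_one]
  have hb := hc.trans hcb
  have ha := hb.trans hba
  have hC := Real.rpow_pos_of_pos hc α
  have hCB := Real.rpow_lt_rpow hc.le hcb hα0
  have hBA := Real.rpow_lt_rpow hb.le hba hα0
  have hslope := (convexOn_rpow_neg (κ := (1 - α) / α)
    (div_nonpos_of_nonpos_of_nonneg (by linarith) hα0.le)).slope_mono_adjacent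
      (mem_Ioi.2 hC) (mem_Ioi.2 (hC.trans (hCB.trans hBA))) hCB hBA
  simp only [hf _ ha, hf _ hb, hf _ hc] at hslope
  simp only [share] at h1 h2 h3
  generalize a ^ α = A at *
  generalize b ^ α = B at *
  generalize c ^ α = C at *
  have hB : 0 < B := hC.trans hCB
  have hA : 0 < A := hB.trans hBA
  have e1 : a / A = (1 / (A + B) + 1 / (A + C)) / 3 := by
    rw [div_eq_iff hA.ne']; linear_combination h1 / 3
  have e2 : b / B = (1 / (A + B) + 1 / (B + C)) / 3 := by
    rw [div_eq_iff hB.ne']; linear_combination (exp := 1) h2 / 3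
  have e3 : c / C = (1 / (A + C) + 1 / (B + C)) / 3 := by
    rw [div_eq_iff hC.ne']; linear_combination h3 / 3
  have s1 : (b / B - c / C) / (B - C) = -(1 / (3 * ((A + B) * (A + C)))) := by
    rw [e2, e3, div_eq_iff (by linarith)]
    field_simp
    ring
  have s2 : (a / A - b / B) / (A - B) = -(1 / (3 * ((A + C) * (B + C)))) := by
    rw [e1, e2, div_eq_iff (by linarith)]
    field_simp
    ring
  -- Increasing chord slopes would give `A + B ≤ B + C`, contradicting `C < A`.
  rw [s1, s2, neg_le_neg_iff, one_div_le_one_div (by positivity) (by positivity)] at hslope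
  nlinarith [mul_pos (add_pos hA hC) (sub_pos.2 (hCB.trans hBA))]

/-! ### Characteristic polynomials. -/

theorem triangleJacobian_apply {α : ℝ} (hα : 1 < α) {v : Fin 3 → ℝ} (hv : ∀ i, 0 ≤ v i)
    (i k : Fin 3) : triangleJacobian α v i k =
      if i = k then
        -1 + α / 3 / v i * ∑ j with j ≠ i, share α (v i) (v j) * share α (v j) (v i)
      else -(α / 3 / v k * (share α (v i) (v k) * share α (v k) (v i))) := by
  rw [triangleJacobian, Matrix.of_apply]
  split_ifs
  · simp only [mul_rpow_sub_one_div_eq hα (hv i), ← Finset.mul_sum]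
    ring
  · rw [mul_right_comm, add_comm, mul_rpow_sub_one_div_eq hα (hv k)]
    ring

/-- The factor `t + 1` appears because every column of the Jacobian sums to -1: what one colour
gains in a competition the other loses. A zero coordinate is covered by the convention `x / 0 = 0`.
-/
theorem det_scalar_sub_triangleJacobian {α a b c : ℝ} (hα : 1 < α) (ha : 0 ≤ a) (hb : 0 ≤ b)
    (hc : 0 ≤ c) {p q r : ℝ} (hp : share α a b * share α b a = p)
    (hq : share α a c * share α c a = q) (hr : share α b c * share α c b = r) (t : ℝ) :
    (Matrix.scalar (Fin 3) t - triangleJacobian α ![a, b, c]).det =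
      (t + 1) * ((t + 1) ^ 2 -
        α / 3 * ((p + q) / a + (p + r) / b + (q + r) / c) * (t + 1) +
        (α / 3) ^ 2 * (p * q + p * r + q * r) *
          (1 / (a * b) + 1 / (a * c) + 1 / (b * c))) := by
  have hv : ∀ i, 0 ≤ ![a, b, c] i := by simp [Fin.forall_fin_succ, *]
  rw [Matrix.det_fin_three]
  simp [triangleJacobian_apply hα hv, Finset.sum_filter, Fin.sum_univ_three, mul_comm (share α b a),
    mul_comm (share α c a), mul_comm (share α c b), hp, hq, hr]
  ring

theorem det_twoEqual_last {α a c s : ℝ} (hα : 1 < α) (ha : 0 < a) (hc : 0 ≤ c)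
    (hs : share α a c * share α c a = s) (t : ℝ) :
    (Matrix.scalar (Fin 3) t - triangleJacobian α ![a, a, c]).det = (t - (-1)) *
      (t - (-1 + α / 3 / a * (1 / 2 + s))) * (t - (-1 + α / 3 * (s * (1 / a + 2 / c)))) := by
  rw [det_scalar_sub_triangleJacobian hα ha.le ha.le hc (p := 1 / 4)
    (by rw [share_self ha]; norm_num) hs hs]
  ring

theorem det_twoEqual_first {α a c s : ℝ} (hα : 1 < α) (ha : 0 < a) (hc : 0 ≤ c)
    (hs : share α a c * share α c a = s) (t : ℝ) :
    (Matrix.scalar (Fin 3) t - triangleJacobian α ![c, a, a]).det = (t - (-1)) *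
      (t - (-1 + α / 3 / a * (1 / 2 + s))) * (t - (-1 + α / 3 * (s * (1 / a + 2 / c)))) := by
  rw [mul_comm] at hs
  rw [det_scalar_sub_triangleJacobian hα hc ha.le ha.le (r := 1 / 4) hs hs
    (by rw [share_self ha]; norm_num)]
  ring

theorem det_oneZero {α a b s : ℝ} (hα : 1 < α) (ha : 0 < a) (hb : 0 < b)
    (hs : share α a b * share α b a = s) (t : ℝ) :
    (Matrix.scalar (Fin 3) t - triangleJacobian α ![a, b, 0]).det = (t - (-1)) *
      (t - (-1)) * (t - (-1 + α / 3 * (s * (1 / a + 1 / b)))) := by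
  rw [det_scalar_sub_triangleJacobian hα ha.le hb.le le_rfl hs (q := 0) (r := 0)
    (by rw [share_zero_left (by linarith), mul_zero])
    (by rw [share_zero_left (by linarith), mul_zero])]
  ring

theorem share_le_one {α a b : ℝ} (ha : 0 ≤ a) (hb : 0 ≤ b) : share α a b ≤ 1 :=
  div_le_one_of_le₀ (le_add_of_nonneg_right (Real.rpow_nonneg hb α))
    (add_nonneg (Real.rpow_nonneg ha α) (Real.rpow_nonneg hb α))

theorem IsTriangleEquilibrium.three_mul_le_two {α : ℝ} {v : Fin 3 → ℝ}
    (h : IsTriangleEquilibrium α v) (i : Fin 3) : 3 * v i ≤ 2 := by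
  rw [h.2.2 i]
  refine (Finset.sum_le_card_nsmul _ _ 1 fun j _ => share_le_one (h.1 i) (h.1 j)).trans ?_
  fin_cases i <;> simp [Finset.filter_ne']

/-- Two vanishing coordinates would force the third to be 1, above the bound 2/3. Hence all shares
are differentiable at an equilibrium. -/
theorem IsTriangleEquilibrium.rpow_add_rpow_ne_zero {α : ℝ} {v : Fin 3 → ℝ}
    (h : IsTriangleEquilibrium α v) (hα : 1 < α) {i j : Fin 3} (hij : i ≠ j) :
    v i ^ α + v j ^ α ≠ 0 := by
  intro h0
  obtain ⟨hi, hj⟩ := (add_eq_zero_iff_of_nonneg (Real.rpow_nonneg (h.1 i) α)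
    (Real.rpow_nonneg (h.1 j) α)).1 h0
  rw [Real.rpow_eq_zero (h.1 _) (by linarith)] at hi hj
  have hsum := h.2.1
  rw [Fin.sum_univ_three] at hsum
  have := h.three_mul_le_two
  have h0 := this 0
  have h1 := this 1
  have h2 := this 2
  fin_cases i <;> fin_cases j <;> simp at hij hi hj <;> linarith

theorem IsTriangleEquilibrium.hasJacobian {α : ℝ} {v : Fin 3 → ℝ}
    (h : IsTriangleEquilibrium α v) (hα : 1 < α) (e : Fin 3 ≃ triangleGraph.edgeSet) :
    HasJacobian (graphLaw triangleGraph e) (powerWeight α) v (triangleJacobian α v) :=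
  hasJacobian_triangleJacobian e hα h.1 fun _ _ hij => h.rpow_add_rpow_ne_zero hα hij

/-! ### Classification of the equilibria. -/

/-- The list of equilibria with decreasing coordinates, in terms of coordinate ratios. -/
theorem IsTriangleEquilibrium.eq_of_antitone {α a b c : ℝ} (hα : 1 < α)
    (h : IsTriangleEquilibrium α ![a, b, c]) (hba : b ≤ a) (hcb : c ≤ b) :
    ![a, b, c] = ![1 / 3, 1 / 3, 1 / 3] ∨ ![a, b, c] = ![1 / 2, 1 / 2, 0] ∨
    (∃ r, 1 < r ∧ r < 2 ∧ r ^ α = (2 * r - 1) / (2 - r) ∧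
      ![a, b, c] = ![r / (1 + r), 1 / (1 + r), 0]) ∨
    (∃ r, 0 < r ∧ r < 1 ∧ r ^ α = 3 * r / (4 - r) ∧
      ![a, b, c] = ![1 / (2 + r), 1 / (2 + r), r / (2 + r)]) ∨
    (∃ r, 1 < r ∧ r < 4 ∧ r ^ α = 3 * r / (4 - r) ∧
      ![a, b, c] = ![r / (2 + r), 1 / (2 + r), 1 / (2 + r)]) := by
  have htwo : ∀ r : ℝ, 0 < r → r ^ α * (4 - r) = 3 * r → r < 4 ∧ r ^ α = 3 * r / (4 - r) := by
    intro r hr h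
    have h4 : 0 < 4 - r := pos_of_mul_pos_right (h ▸ by positivity) (Real.rpow_nonneg hr.le α)
    exact ⟨by linarith, by rw [eq_div_iff h4.ne', h]⟩
  obtain ⟨⟨ha, hb, hc⟩, hsum, -⟩ := isTriangleEquilibrium_vec_iff.1 h
  -- If `b = 0` then `c = 0` and `a = 1 > 2 / 3`. Positivity allows `b` to serve as the unit for the
  -- ratios.
  have hb0 : 0 < b := by
    refine hb.lt_of_ne' fun hb0 => ?_
    have := h.three_mul_le_two 0
    simp only [Matrix.cons_val_zero] at this
    linarith
  rcases hba.eq_or_lt with rfl | hba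
  · obtain ⟨r, rfl⟩ : ∃ r, c = r * b := ⟨c / b, by field_simp⟩
    have hr0 : 0 ≤ r := nonneg_of_mul_nonneg_left hc hb0
    have hr1 : r ≤ 1 := le_of_mul_le_mul_right (by linarith) hb0
    have hb' : b = 1 / (2 + r) := by rw [eq_div_iff (by linarith)]; linarith
    have hv : ![b, b, r * b] = ![1 / (2 + r), 1 / (2 + r), r / (2 + r)] := by
      rw [hb', mul_one_div]
    rw [hv] at h ⊢
    rcases hr0.eq_or_lt with rfl | hr0
    · exact Or.inr (Or.inl (by norm_num))
    rcases hr1.eq_or_lt with rfl | hr1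
    · exact Or.inl (by norm_num)
    obtain ⟨_, h5⟩ := htwo r hr0 ((isTriangleEquilibrium_twoEqual_iff hr0.le).1 h)
    exact Or.inr (Or.inr (Or.inr (Or.inl ⟨r, hr0, hr1, h5, rfl⟩)))
  obtain ⟨r, rfl⟩ : ∃ r, a = r * b := ⟨a / b, by field_simp⟩
  have hr1 : 1 < r := lt_of_mul_lt_mul_right (by linarith) hb
  rcases hcb.eq_or_lt with rfl | hcb
  · have hb' : c = 1 / (2 + r) := by rw [eq_div_iff (by linarith)]; linarith
    have hv : ![r * c, c, c] = ![r / (2 + r), 1 / (2 + r), 1 / (2 + r)] := by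
      rw [hb', mul_one_div]
    rw [hv] at h ⊢
    have h' := h.comp_perm (Equiv.swap 0 2)
    rw [show ![r / (2 + r), 1 / (2 + r), 1 / (2 + r)] ∘ Equiv.swap (0 : Fin 3) 2 =
      ![1 / (2 + r), 1 / (2 + r), r / (2 + r)] by ext i; fin_cases i <;> rfl] at h'
    obtain ⟨h4, h5⟩ := htwo r (by linarith) ((isTriangleEquilibrium_twoEqual_iff (by linarith)).1 h')
    exact Or.inr (Or.inr (Or.inr (Or.inr ⟨r, hr1, h4, h5, rfl⟩)))
  rcases hc.eq_or_lt with rfl | hc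
  · have hb' : b = 1 / (1 + r) := by rw [eq_div_iff (by linarith)]; linarith
    have hv : ![r * b, b, 0] = ![r / (1 + r), 1 / (1 + r), 0] := by
      rw [hb', mul_one_div]
    rw [hv] at h ⊢
    have h' := (isTriangleEquilibrium_oneZero_iff hα (by linarith)).1 h
    have h2 : 0 < 2 - r := pos_of_mul_pos_right (a := r ^ α) (h' ▸ by linarith)
      (Real.rpow_nonneg (by linarith) α)
    exact Or.inr (Or.inr (Or.inl ⟨r, hr1, by linarith, by rw [eq_div_iff h2.ne', h'], rfl⟩))
  · exact absurd h (not_isTriangleEquilibrium_of_lt hα hc hcb hba)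

theorem exists_perm_comp_eq_antitone (v : Fin 3 → ℝ) :
    ∃ (σ : Equiv.Perm (Fin 3)) (a b c : ℝ), v ∘ σ = ![a, b, c] ∧ b ≤ a ∧ c ≤ b := by
  have hm := Tuple.monotone_sort fun i => -v i
  refine ⟨Tuple.sort fun i => -v i, _, _, _,
    (by ext i; fin_cases i <;> rfl : _ = ![_, _, _]), ?_, ?_⟩
  · exact neg_le_neg_iff.1 (hm (show (0 : Fin 3) ≤ 1 by decide))
  · exact neg_le_neg_iff.1 (hm (show (1 : Fin 3) ≤ 2 by decide))

/-! ### Stability of each family in terms of the ratio. -/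

section Stability

variable (e : Fin 3 ≃ triangleGraph.edgeSet) {α r : ℝ} (hα : 1 < α)

-- The equilibrium equations express the shares rationally in `r`, so no power survives in the
-- eigenvalues. The second one is `-1 + α / h' y` for `h = twoEqualExponent` and `r = exp y`.
include hα in
theorem stability_twoEqual (hr : 0 < r) (h : r ^ α * (4 - r) = 3 * r) {v : Fin 3 → ℝ}
    (hv : v = ![1 / (2 + r), 1 / (2 + r), r / (2 + r)] ∨
      v = ![r / (2 + r), 1 / (2 + r), 1 / (2 + r)]) :
    (IsLinearlyStable (graphLaw triangleGraph e) (powerWeight α) v ↔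
      -1 + α * (8 + 20 * r - r ^ 2) / (12 * (2 + r)) < 0 ∧ -1 + α * (4 - r) / 4 < 0) ∧
    (IsCritical (graphLaw triangleGraph e) (powerWeight α) v ↔
      max (-1 + α * (8 + 20 * r - r ^ 2) / (12 * (2 + r))) (-1 + α * (4 - r) / 4) = 0) := by
  have heq := (isTriangleEquilibrium_twoEqual_iff hr.le).2 h
  have h2 : 0 < 2 + r := by linarith
  obtain ⟨_, _, h1, _, h3⟩ := isTriangleEquilibrium_vec_iff.1 heq
  rw [share_self (by positivity)] at h1
  have hs : share α (1 / (2 + r)) (r / (2 + r)) * share α (r / (2 + r)) (1 / (2 + r)) =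
      3 * r * (4 - r) / (4 * (2 + r) ^ 2) := by
    rw [show share α (1 / (2 + r)) (r / (2 + r)) = 3 * (1 / (2 + r)) - 1 / 2 by linarith,
      show share α (r / (2 + r)) (1 / (2 + r)) = 3 * (r / (2 + r)) / 2 by linarith]
    field_simp
    ring
  have e1 : -1 + α * (8 + 20 * r - r ^ 2) / (12 * (2 + r)) =
      -1 + α / 3 / (1 / (2 + r)) * (1 / 2 + 3 * r * (4 - r) / (4 * (2 + r) ^ 2)) := by
    field_simp
    ring
  have e2 : -1 + α * (4 - r) / 4 = -1 + α / 3 * (3 * r * (4 - r) / (4 * (2 + r) ^ 2) *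
      (1 / (1 / (2 + r)) + 2 / (r / (2 + r)))) := by
    field_simp
    ring
  have hveq : IsTriangleEquilibrium α v := by
    rcases hv with rfl | rfl
    · exact heq
    · refine IsTriangleEquilibrium.of_comp_perm (Equiv.swap 0 2) ?_
      convert! heq using 1
      ext i
      fin_cases i <;> rfl
  have hdet : ∀ t, (Matrix.scalar (Fin 3) t - triangleJacobian α v).det =
      (t - (-1)) * (t - (-1 + α * (8 + 20 * r - r ^ 2) / (12 * (2 + r)))) *
        (t - (-1 + α * (4 - r) / 4)) := by
    intro t
    rw [e1, e2]
    rcases hv with rfl | rfl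
    · exact det_twoEqual_last hα (by positivity) (by positivity) hs t
    · exact det_twoEqual_first hα (by positivity) (by positivity) hs t
  have hveq' := (isEquilibrium_triangleGraph_iff e α v).2 hveq
  exact ⟨isLinearlyStable_iff_of_det hveq' (hveq.hasJacobian hα e) hdet,
    isCritical_iff_of_det hveq' (hveq.hasJacobian hα e) hdet⟩

include hα in
theorem stability_oneZero (hr : 0 < r) (h : r ^ α * (2 - r) = 2 * r - 1) :
    (IsLinearlyStable (graphLaw triangleGraph e) (powerWeight α)
        ![r / (1 + r), 1 / (1 + r), 0] ↔
      -1 < (0 : ℝ) ∧ -1 + α * ((2 * r - 1) * (2 - r)) / (3 * r) < 0) ∧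
    (IsCritical (graphLaw triangleGraph e) (powerWeight α) ![r / (1 + r), 1 / (1 + r), 0] ↔
      max (-1) (-1 + α * ((2 * r - 1) * (2 - r)) / (3 * r)) = 0) := by
  have heq := (isTriangleEquilibrium_oneZero_iff hα hr).2 h
  have h2 : 0 < 1 + r := by linarith
  have hα0 : α ≠ 0 := by linarith
  obtain ⟨_, _, h1, h3, _⟩ := isTriangleEquilibrium_vec_iff.1 heq
  rw [share_zero_right hα0 (by positivity)] at h1 h3
  have hs : share α (r / (1 + r)) (1 / (1 + r)) * share α (1 / (1 + r)) (r / (1 + r)) =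
      (2 * r - 1) * (2 - r) / (1 + r) ^ 2 := by
    rw [show share α (r / (1 + r)) (1 / (1 + r)) = 3 * (r / (1 + r)) - 1 by linarith,
      show share α (1 / (1 + r)) (r / (1 + r)) = 3 * (1 / (1 + r)) - 1 by linarith]
    field_simp
    ring
  have e1 : -1 + α * ((2 * r - 1) * (2 - r)) / (3 * r) =
      -1 + α / 3 * ((2 * r - 1) * (2 - r) / (1 + r) ^ 2 *
        (1 / (r / (1 + r)) + 1 / (1 / (1 + r)))) := by
    field_simp
  have hdet := det_oneZero hα (by positivity) (by positivity) hs
  rw [← e1] at hdet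
  have heq' := (isEquilibrium_triangleGraph_iff e α _).2 heq
  exact ⟨isLinearlyStable_iff_of_det heq' (heq.hasJacobian hα e) hdet,
    isCritical_iff_of_det heq' (heq.hasJacobian hα e) hdet⟩

end Stability

theorem isEquilibrium_twoEdgeGraph (e : Fin 2 ≃ twoEdgeGraph.edgeSet) {α r : ℝ} (hα : 1 < α)
    (hr : 0 < r) (h : r ^ α * (2 - r) = 2 * r - 1) :
    IsEquilibrium (graphLaw twoEdgeGraph e) (powerWeight α) ![r / (1 + r), 1 / (1 + r)] := by
  have hα0 : α ≠ 0 := by linarith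
  have hpos1 : 0 < r / (1 + r) := by positivity
  have hpos2 : 0 < 1 / (1 + r) := by positivity
  obtain ⟨_, hsum, h1, h2, _⟩ := isTriangleEquilibrium_vec_iff.1
    ((isTriangleEquilibrium_oneZero_iff hα hr).2 h)
  rw [share_zero_right hα0 hpos1] at h1
  rw [share_zero_right hα0 hpos2] at h2
  refine ⟨⟨?_, ?_⟩, fun i => ?_⟩
  · simp [Fin.forall_fin_succ, hpos1.le, (one_pos.trans_le (by linarith : 1 ≤ 1 + r)).le]
  · rw [Fin.sum_univ_two]
    simpa using hsum
  · rw [warmField_twoEdgeGraph e α (by simpa [Fin.forall_fin_succ] using ⟨hpos1, by linarith⟩)]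
    fin_cases i <;> simp at h1 h2 ⊢ <;> linarith

/-! ### Assembling the branches. -/

theorem theorem10 :
    ∃ v₃ v₄ v₅ : ℝ → ℝ,
      -- the branch `(v, u, 0)` on `α > 3`
      (StrictMonoOn v₃ (Ioi 3) ∧ (∀ α > 3, 1 - v₃ α < v₃ α) ∧
        Tendsto v₃ (𝓝[>] 3) (𝓝 (1 / 2)) ∧ Tendsto v₃ atTop (𝓝 (2 / 3)) ∧
        ∀ α > 3, ∀ e : Fin 2 ≃ twoEdgeGraph.edgeSet,
          IsEquilibrium (graphLaw twoEdgeGraph e) (powerWeight α) ![v₃ α, 1 - v₃ α]) ∧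
      -- the branch `(v, v, u)` on `1 < α ≤ 4 / 3`
      (StrictAntiOn v₄ (Ioc 1 (4 / 3)) ∧ (∀ α, 1 < α → α < 4 / 3 → 1 - 2 * v₄ α < v₄ α) ∧
        Tendsto v₄ (𝓝[>] 1) (𝓝 (1 / 2)) ∧ Tendsto v₄ (𝓝[<] (4 / 3)) (𝓝 (1 / 3)) ∧
        v₄ (4 / 3) = 1 / 3) ∧
      -- the branch `(v, u, u)` on `α ≥ 4 / 3`
      (StrictMonoOn v₅ (Ici (4 / 3)) ∧ (∀ α > 4 / 3, (1 - v₅ α) / 2 < v₅ α) ∧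
        Tendsto v₅ (𝓝[>] (4 / 3)) (𝓝 (1 / 3)) ∧ Tendsto v₅ atTop (𝓝 (2 / 3)) ∧
        v₅ (4 / 3) = 1 / 3) ∧
      ∀ α : ℝ, 1 < α → ∀ e : Fin 3 ≃ triangleGraph.edgeSet,
        -- the complete list of equilibria, up to a permutation of the coordinates
        (∀ x : Fin 3 → ℝ, IsEquilibrium (graphLaw triangleGraph e) (powerWeight α) x ↔
          ∃ σ : Equiv.Perm (Fin 3),
            x ∘ σ = ![1 / 3, 1 / 3, 1 / 3] ∨
            x ∘ σ = ![1 / 2, 1 / 2, 0] ∨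
            (3 < α ∧ x ∘ σ = ![v₃ α, 1 - v₃ α, 0]) ∨
            (α ≤ 4 / 3 ∧ x ∘ σ = ![v₄ α, v₄ α, 1 - 2 * v₄ α]) ∨
            (4 / 3 ≤ α ∧ x ∘ σ = ![v₅ α, (1 - v₅ α) / 2, (1 - v₅ α) / 2])) ∧
        -- at every equilibrium all the partial derivatives exist
        (∀ x : Fin 3 → ℝ, IsEquilibrium (graphLaw triangleGraph e) (powerWeight α) x →
          ∃ D, HasJacobian (graphLaw triangleGraph e) (powerWeight α) x D) ∧
        -- stability
        (IsLinearlyStable (graphLaw triangleGraph e) (powerWeight α) ![1 / 3, 1 / 3, 1 / 3] ↔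
          α < 4 / 3) ∧
        (IsCritical (graphLaw triangleGraph e) (powerWeight α) ![1 / 3, 1 / 3, 1 / 3] ↔
          α = 4 / 3) ∧
        (IsLinearlyStable (graphLaw triangleGraph e) (powerWeight α) ![1 / 2, 1 / 2, 0] ↔
          α < 3) ∧
        (IsCritical (graphLaw triangleGraph e) (powerWeight α) ![1 / 2, 1 / 2, 0] ↔
          α = 3) ∧
        (3 < α →
          IsLinearlyStable (graphLaw triangleGraph e) (powerWeight α) ![v₃ α, 1 - v₃ α, 0]) ∧
        (α ≤ 4 / 3 →
          ¬ IsLinearlyStable (graphLaw triangleGraph e) (powerWeight α)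
              ![v₄ α, v₄ α, 1 - 2 * v₄ α] ∧
          (IsCritical (graphLaw triangleGraph e) (powerWeight α)
              ![v₄ α, v₄ α, 1 - 2 * v₄ α] ↔ α = 4 / 3)) ∧
        (4 / 3 ≤ α →
          ¬ IsLinearlyStable (graphLaw triangleGraph e) (powerWeight α)
              ![v₅ α, (1 - v₅ α) / 2, (1 - v₅ α) / 2] ∧
          (IsCritical (graphLaw triangleGraph e) (powerWeight α)
              ![v₅ α, (1 - v₅ α) / 2, (1 - v₅ α) / 2] ↔ α = 4 / 3)) := by
  obtain ⟨ρ, hρ, hρmono, hρuniq, hρ1, hρlt, hρgt, hρlim1, hρlim2, hρlim3⟩ := exists_twoEqualRatio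
  obtain ⟨κ, hκ, hκmono, hκuniq, hκlim1, hκlim2⟩ := exists_oneZeroRatio
  have hκeq : ∀ α > 3, κ α ^ α * (2 - κ α) = 2 * κ α - 1 := fun α hα => by
    obtain ⟨_, h2, h, _⟩ := hκ α hα
    rw [h, div_mul_cancel₀ _ (by linarith)]
  have hρeq : ∀ α > 1, ρ α ^ α * (4 - ρ α) = 3 * ρ α := fun α hα => by
    obtain ⟨_, h4, h⟩ := hρ α hα
    rw [h, div_mul_cancel₀ _ (by linarith)]
  have e3 : ∀ α > 3, 1 - κ α / (1 + κ α) = 1 / (1 + κ α) := fun α hα => by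
    have := (hκ α hα).1
    field_simp
    ring
  have e4 : ∀ α > 1, 1 - 2 * (1 / (2 + ρ α)) = ρ α / (2 + ρ α) := fun α hα => by
    have := (hρ α hα).1
    field_simp
    ring
  have e5 : ∀ α > 1, (1 - ρ α / (2 + ρ α)) / 2 = 1 / (2 + ρ α) := fun α hα => by
    have := (hρ α hα).1
    field_simp
    ring
  -- `v₄` and `v₅` come from one ratio curve `ρ`, read off at an equal coordinate and at the odd
  -- one; they meet where `ρ (4 / 3) = 1`.
  refine ⟨fun α => κ α / (1 + κ α), fun α => 1 / (2 + ρ α), fun α => ρ α / (2 + ρ α),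
    ⟨?_, ?_, ?_, ?_, ?_⟩, ⟨?_, ?_, ?_, ?_, ?_⟩, ⟨?_, ?_, ?_, ?_, ?_⟩, fun α hα e => ?_⟩
  · intro α hα β hβ hlt
    have h1 := (hκ α hα).1
    have h2 := (hκ β hβ).1
    have h3 := hκmono hα hβ hlt
    simp only
    rw [div_lt_div_iff₀ (by linarith) (by linarith)]
    linarith
  · intro α hα
    have h1 := (hκ α hα).1
    rw [e3 α hα]
    exact div_lt_div_of_pos_right h1 (by linarith)
  · have := hκlim1.div (hκlim1.const_add 1) (by norm_num)
    norm_num at this ⊢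
    exact this
  · have := hκlim2.div (hκlim2.const_add 1) (by norm_num)
    norm_num at this ⊢
    exact this
  · intro α hα e
    rw [e3 α hα]
    exact isEquilibrium_twoEdgeGraph e (by linarith) (by linarith [(hκ α hα).1]) (hκeq α hα)
  · intro α hα β hβ hlt
    have h1 := (hρ α hα.1).1
    exact one_div_lt_one_div_of_lt (by linarith) (by linarith [hρmono hα.1 hβ.1 hlt])
  · intro α hα hα'
    have h1 := (hρ α hα).1
    rw [e4 α hα]
    exact div_lt_div_of_pos_right (hρlt α hα hα').1 (by linarith)
  · have := (hρlim1.const_add 2).inv₀ (by norm_num)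
    norm_num at this ⊢
    exact this
  · have := (hρlim2.const_add 2).inv₀ (by norm_num)
    norm_num at this ⊢
    exact this.mono_left nhdsWithin_le_nhds
  · simp only [hρ1]
    norm_num
  · intro α hα β hβ hlt
    have hα1 : 1 < α := lt_of_lt_of_le (by norm_num) (mem_Ici.1 hα)
    have hβ1 : 1 < β := lt_of_lt_of_le (by norm_num) (mem_Ici.1 hβ)
    have h1 := (hρ α hα1).1
    have h2 := (hρ β hβ1).1
    have h3 := hρmono hα1 hβ1 hlt
    simp only
    rw [div_lt_div_iff₀ (by linarith) (by linarith)]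
    linarith
  · intro α hα
    have h1 := hρgt α hα
    rw [e5 α (lt_trans (by norm_num) hα)]
    exact div_lt_div_of_pos_right h1 (by linarith)
  · have := hρlim2.div (hρlim2.const_add 2) (by norm_num)
    norm_num at this ⊢
    exact this.mono_left nhdsWithin_le_nhds
  · have := hρlim3.div (hρlim3.const_add 2) (by norm_num)
    norm_num at this ⊢
    exact this
  · simp only [hρ1]
    norm_num
  have hρ0 := (hρ α hα).1
  have hρ4 := (hρ α hα).2.1
  have hhalf : (![1 / (1 + 1), 1 / (1 + 1), 0] : Fin 3 → ℝ) = ![1 / 2, 1 / 2, 0] := by norm_num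
  have hthird : (![1 / (2 + 1), 1 / (2 + 1), 1 / (2 + 1)] : Fin 3 → ℝ) = ![1 / 3, 1 / 3, 1 / 3] := by
    norm_num
  have hrev : ∀ a b : ℝ, ![a, b, b] ∘ Equiv.swap (0 : Fin 3) 2 = ![b, b, a] := fun a b => by
    ext i
    fin_cases i <;> rfl
  simp only [isEquilibrium_triangleGraph_iff, e4 α hα, e5 α hα]
  refine ⟨fun x => ⟨fun hx => ?_, ?_⟩, fun x hx => ⟨_, hx.hasJacobian hα e⟩, ?_⟩
  · obtain ⟨σ, a, b, c, hσ, hba, hcb⟩ := exists_perm_comp_eq_antitone x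
    refine ⟨σ, ?_⟩
    have hx' := hσ ▸ hx.comp_perm σ
    rw [hσ]
    rcases hx'.eq_of_antitone hα hba hcb with h | h | ⟨r, hr1, hr2, hr, h⟩ | ⟨r, hr0, hr1, hr, h⟩ |
      ⟨r, hr1, hr4, hr, h⟩
    · exact Or.inl h
    · exact Or.inr (Or.inl h)
    · obtain ⟨h3, rfl⟩ := hκuniq α r hr1 hr2 hr
      exact Or.inr (Or.inr (Or.inl ⟨h3, by rw [h, e3 α h3]⟩))
    · obtain rfl := hρuniq α hα r hr0 (by linarith) hr1.ne hr
      refine Or.inr (Or.inr (Or.inr (Or.inl ⟨?_, h⟩)))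
      by_contra! hcon
      linarith [hρgt α hcon]
    · obtain rfl := hρuniq α hα r (by linarith) hr4 hr1.ne' hr
      refine Or.inr (Or.inr (Or.inr (Or.inr ⟨?_, h⟩)))
      by_contra! hcon
      linarith [(hρlt α hα hcon).1]
  · rintro ⟨σ, h⟩
    refine IsTriangleEquilibrium.of_comp_perm σ ?_
    rcases h with h | h | ⟨h3, h⟩ | ⟨_, h⟩ | ⟨_, h⟩ <;> rw [h]
    · have := (isTriangleEquilibrium_twoEqual_iff (α := α) zero_le_one).2 (by norm_num)
      rwa [hthird] at this
    · have := (isTriangleEquilibrium_oneZero_iff hα one_pos).2 (by norm_num)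
      rwa [hhalf] at this
    · rw [e3 α h3]
      exact (isTriangleEquilibrium_oneZero_iff hα (by linarith [(hκ α h3).1])).2 (hκeq α h3)
    · exact (isTriangleEquilibrium_twoEqual_iff hρ0.le).2 (hρeq α hα)
    · refine IsTriangleEquilibrium.of_comp_perm (Equiv.swap 0 2) ?_
      rw [hrev]
      exact (isTriangleEquilibrium_twoEqual_iff hρ0.le).2 (hρeq α hα)
  have hs1 := stability_twoEqual e hα one_pos (by norm_num) (Or.inl rfl)
  have hs2 := stability_oneZero e hα one_pos (by norm_num)
  rw [hthird] at hs1
  rw [hhalf] at hs2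
  have hunstable : ∀ v : Fin 3 → ℝ, (v = ![1 / (2 + ρ α), 1 / (2 + ρ α), ρ α / (2 + ρ α)] ∨
      v = ![ρ α / (2 + ρ α), 1 / (2 + ρ α), 1 / (2 + ρ α)]) →
      ¬ IsLinearlyStable (graphLaw triangleGraph e) (powerWeight α) v ∧
      (IsCritical (graphLaw triangleGraph e) (powerWeight α) v ↔ α = 4 / 3) := by
    intro v hv
    obtain ⟨h1, h2⟩ := stability_twoEqual e hα hρ0 (hρeq α hα) hv
    rw [h1, h2]
    rcases lt_trichotomy α (4 / 3) with h | h | h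
    · obtain ⟨_, hlt⟩ := hρlt α hα h
      rw [div_lt_iff₀ (by linarith)] at hlt
      have hpos : 0 < -1 + α * (4 - ρ α) / 4 := by linarith
      exact ⟨fun h => hpos.not_gt h.2,
        iff_of_false (fun h => (lt_max_of_lt_right hpos).ne' h) h.ne⟩
    · rw [h, hρ1]
      norm_num
    · have h1 := hρgt α h
      have hpos : 0 < -1 + α * (8 + 20 * ρ α - ρ α ^ 2) / (12 * (2 + ρ α)) := by
        rw [neg_add_eq_sub, sub_pos, lt_div_iff₀ (by linarith), one_mul]
        -- At `α = 4 / 3` the inequality amounts to `(ρ - 1) * (10 - ρ) > 0`; a larger `α` only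
        -- helps.
        nlinarith [mul_pos (sub_pos.2 h1) (show 0 < 10 - ρ α by linarith)]
      exact ⟨fun h => hpos.not_gt h.1,
        iff_of_false (fun h => (lt_max_of_lt_left hpos).ne' h) h.ne'⟩
  refine ⟨?_, ?_, ?_, ?_, fun h3 => ?_, fun _ => hunstable _ (Or.inl rfl),
    fun _ => hunstable _ (Or.inr rfl)⟩
  · rw [hs1.1]
    constructor
    · rintro ⟨_, h⟩
      linarith
    · intro h
      constructor <;> linarith
  · rw [hs1.2, show -1 + α * (8 + 20 * 1 - 1 ^ 2) / (12 * (2 + 1)) = -1 + α * (4 - 1) / 4 by ring,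
      max_self]
    constructor <;> intro h <;> linarith
  · rw [hs2.1]
    constructor
    · rintro ⟨_, h⟩
      linarith
    · intro h
      constructor <;> linarith
  · rw [hs2.2]
    constructor
    · intro h
      rcases max_choice (-1) (-1 + α * ((2 * 1 - 1) * (2 - 1)) / (3 * 1)) with h' | h' <;>
        rw [h'] at h <;> linarith
    · rintro rfl
      norm_num
  · obtain ⟨h1, h2, _, h⟩ := hκ α h3
    rw [e3 α h3]
    refine (stability_oneZero e hα (by linarith) (hκeq α h3)).1.2 ⟨by norm_num, ?_⟩
    have hpos : 0 < (2 * κ α - 1) * (2 - κ α) := mul_pos (by linarith) (by linarith)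
    rw [neg_add_lt_iff_lt_add, add_zero, div_lt_one (by linarith)]
    rwa [lt_div_iff₀ hpos] at h
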